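/- Let $S\subset\mathbb{R}^n$ be closed and convex, let $\phi:\mathbb{R}^n\times\mathbb{R}^n\to\mathbb{R}$ satisfy $\phi(x,x)=0$ for all $x\in S$, and let $\bar S=\{x\in S\mid \phi(x,y)\ge 0\ \ \forall y\in S\}$ be the solution set of the equilibrium problem $EP(\phi,S)$, assumed nonempty. Notation. For $C\subset\mathbb{R}^n$, $x\in C$: $T_C(x)$ is the tangent cone, i.e. the set of all limits of $(y^k-x)/\tau^k$ with $y^k\in C$, $y^k\to x$, $\tau^k\downarrow 0$; $\hat N_C(x)=\{d\mid \langle d,y-x\rangle\le o(\|y-x\|),\ y\in C\}$ is the regular normal cone; $C^\circ=\{y\mid\langle y,x\rangle\le 0\ \ \forall x\in C\}$ is the polar cone; $P_C(x)$ is the point of $C$ nearest to $x$ (a nearest point, if there are several); $B$ is the closed unit ball. For $f:\mathbb{R}^n\to\mathbb{R}$, $v$ is a regular subgradient of $f$ at $x$ if $f(y)\ge f(x)+\langle v,y-x\rangle+o(\|y-x\|)$ as $y\to x$, and $\partial f(x)$ is the limiting subdifferential: the set of limits of regular subgradients $v^k$ of $f$ at points $y^k$ with $y^k\to x$, $f(y^k)\to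 f(x)$. $\partial_y\phi(x,x)$ is the limiting subdifferential of $\phi(x,\cdot)$ at $x$, and $P_{T_S(x)}(-\partial_y\phi(x,x))=\{P_{T_S(x)}(-u)\mid u\in\partial_y\phi(x,x)\}$. For sets $C^k\subset\mathbb{R}^n$, $\liminf_{k\to\infty}C^k$ is the set of limits of convergent sequences $c^k$ with $c^k\in C^k$ for all $k$. For $\{x^k\}\subset S$, $\bar S$ is called augmented weakly sharp with respect to $\{x^k\}$ if, whenever $K=\{k\mid x^k\notin\bar S\}$ is infinite, there are a set-valued mapping $H:\bar S\to 2^{\mathbb{R}^n}$ and nearest points $z^k=P_{\bar S}(x^k)$, $k\in K$, such that (a) for some constant $\alpha>0$, $\alpha B\subset H(z)+[T_S(z)\cap\hat N_{\bar S}(z)]^\circ$ for all $z\in\bar S$; (b) for all $u^k\in\partial_y\phi(x^k,x^k)$ and $v^k\in H(z^k)$ $(k\in K)$, $$\limsup_{k\in K,\,k\to\infty}\frac{\langle u^k-v^k,\,x^k-z^k\rangle}{\|x^k-z^k\|}\ge 0 .$$ Claim. Suppose that $\bar S$ is closed, that $\phi(x,\cdot)$ is locally Lipschitz on $\mathbb{R}^n$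 for every $x\in S$, and that $\bar S$ is augmented weakly sharp with respect to a sequence $\{x^k\}\subset S$. Then $\{x^k\}$ terminates finitely in $\bar S$, i.e. $x^k\in\bar S$ for all sufficiently large $k$, if and only if $$0\in\liminf_{k\to\infty}P_{T_S(x^k)}\bigl(-\partial_y\phi(x^k,x^k)\bigr).$$ -/

import Mathlib

open Filter Topology
open scoped Pointwise

namespace EquilibriumProblem

variable {E : Type*} [NormedAddCommGroup E] [InnerProductSpace ℝ E]

/-- The solution set of the equilibrium problem `EP(φ, S)`: the points `x ∈ S` with
`φ x y ≥ 0` for all `y ∈ S`. -/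
def solutionSet (φ : E → E → ℝ) (S : Set E) : Set E :=
  {x | x ∈ S ∧ ∀ y ∈ S, 0 ≤ φ x y}

/-- The (Bouligand) tangent cone of `C` at `x`: all limits of `(yₖ - x) / τₖ` with `yₖ ∈ C`,
`yₖ → x` and `τₖ ↓ 0`. -/
def tangentCone (C : Set E) (x : E) : Set E :=
  {d | ∃ (y : ℕ → E) (τ : ℕ → ℝ), (∀ k, y k ∈ C) ∧ Tendsto y atTop (𝓝 x) ∧
    (∀ k, 0 < τ k) ∧ Tendsto τ atTop (𝓝 0) ∧
    Tendsto (fun k => (τ k)⁻¹ • (y k - x)) atTop (𝓝 d)}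

/-- The regular normal cone of `C` at `x`: the `d` with `⟪d, y - x⟫ ≤ o(‖y - x‖)` as
`y → x` in `C`. -/
def regularNormalCone (C : Set E) (x : E) : Set E :=
  {d | ∀ ε > 0, ∀ᶠ y in 𝓝[C] x, inner ℝ d (y - x) ≤ ε * ‖y - x‖}

/-- The polar cone `C° = {y | ⟪y, x⟫ ≤ 0 for all x ∈ C}`. -/
def polarCone (C : Set E) : Set E :=
  {y | ∀ x ∈ C, inner ℝ y x ≤ 0}

/-- The metric projection of `x` on `C`, as the set of all points of `C` nearest to `x`. It is a
single point if `C` is a nonempty closed convex set in a Euclidean space. -/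
def proj (C : Set E) (x : E) : Set E :=
  {p | p ∈ C ∧ ∀ y ∈ C, ‖p - x‖ ≤ ‖y - x‖}

/-- The regular (Fréchet) subdifferential of `f` at `x`: the `v` with
`f y ≥ f x + ⟪v, y - x⟫ + o(‖y - x‖)` as `y → x`. -/
def regularSubdifferential (f : E → ℝ) (x : E) : Set E :=
  {v | ∀ ε > 0, ∀ᶠ y in 𝓝 x, f x + inner ℝ v (y - x) - ε * ‖y - x‖ ≤ f y}

/-- The general (limiting) subdifferential of `f` at `x`: the limits of regular subgradients
`vₖ` of `f` at points `yₖ → x` with `f yₖ → f x`. -/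
def subdifferential (f : E → ℝ) (x : E) : Set E :=
  {v | ∃ (y w : ℕ → E), Tendsto y atTop (𝓝 x) ∧ Tendsto (fun k => f (y k)) atTop (𝓝 (f x)) ∧
    (∀ k, w k ∈ regularSubdifferential f (y k)) ∧ Tendsto w atTop (𝓝 v)}

/-- The projected subdifferential `P_{T_C(x)}(-∂f(x)) = {P_{T_C(x)}(-u) | u ∈ ∂f(x)}`. -/
def projectedSubdifferential (C : Set E) (f : E → ℝ) (x : E) : Set E :=
  {p | ∃ u ∈ subdifferential f x, p ∈ proj (tangentCone C x) (-u)}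

/-- The lower limit of a sequence of sets: the limits of sequences `cₖ ∈ C k`. -/
def setLiminf (C : ℕ → Set E) : Set E :=
  {x | ∃ c : ℕ → E, (∀ k, c k ∈ C k) ∧ Tendsto c atTop (𝓝 x)}

/-- The solution set `T` of `EP(φ, S)` is augmented weakly sharp with respect to the sequence `x`:
if `K = {k | x k ∉ T}` is infinite, there is a set-valued mapping `H` on `T` (only its values at
points of `T` matter) with

* for some `α > 0`, `α B ⊆ H z + [T_S(z) ∩ N̂_T(z)]°` for all `z ∈ T`, `B` the unit ball;
* whenever `u k ∈ ∂_y φ(x k, x k)` and `v k ∈ H (z k)` for all `k ∈ K`, the upper limit over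
  `k ∈ K` (in the extended reals) of `⟪u k - v k, x k - z k⟫ / ‖x k - z k‖` is nonnegative.

Here `z k = P_T(x k)` is the projection of `x k` on `T`. Where `x k` has several nearest points in
`T`, `z k` may be any one of them: some choice of the `z k` has to satisfy the condition. -/
def AugmentedWeaklySharp (φ : E → E → ℝ) (S : Set E) (x : ℕ → E) : Prop :=
  let T := solutionSet φ S
  let K := {k | x k ∉ T}
  K.Infinite → ∃ (H : E → Set E) (z : ℕ → E), (∀ k ∈ K, z k ∈ proj T (x k)) ∧
    (∃ α : ℝ, 0 < α ∧ ∀ y ∈ T,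
      α • Metric.closedBall (0 : E) 1 ⊆
        H y + polarCone (tangentCone S y ∩ regularNormalCone T y)) ∧
    (∀ u v : ℕ → E, (∀ k ∈ K, u k ∈ subdifferential (φ (x k)) (x k)) →
      (∀ k ∈ K, v k ∈ H (z k)) →
      (0 : EReal) ≤ limsup
        (fun k => ((1 / ‖x k - z k‖ * inner ℝ (u k - v k) (x k - z k) : ℝ) : EReal))
        (atTop ⊓ 𝓟 K))

/-- The sequence `x` terminates finitely in `C`. -/
def TerminatesFinitely (x : ℕ → E) (C : Set E) : Prop :=
  ∃ k₀, ∀ k ≥ k₀, x k ∈ C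

end EquilibriumProblem

/-! Only two facts about the tangent cone `T_S(a)` of the convex set `S` matter besides its
closedness: it contains every `b - a` with `b ∈ S`, and it is stable under adding positive
multiples of such vectors (`add_smul_mem_tangentCone`).

*Sufficiency.* Let `p ∈ P_{T_S(x)}(-u)` and let `z` be a point of the solution set nearest to
`x ≠ z`, with `d = (x - z) / ‖x - z‖`. Moving `p` in the direction `z - x` stays in `T_S(x)`, so
that `⟪u, d⟫ ≤ ‖p‖` (`inner_le_of_mem_proj_tangentCone`). On the other hand `d` lies in
`T_S(z) ∩ N̂(z)`, and decomposing `α d` by condition (a) gives some `v ∈ H z` with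
`α ≤ ⟪v, d⟫` (`exists_le_inner_of_smul_closedBall_subset`). Along iterates outside the solution
set, `‖p‖ → 0` would force the upper limit in condition (b) to be at most `-α / 2`.

*Necessity.* A solution `x` minimizes `φ x` over `S`, so what is needed is the optimality condition
`0 ∈ ∂f(x) + N_S(x)` for locally Lipschitz `f`: it provides `u ∈ ∂f(x)` with `-u` in the polar of
`T_S(x)`, hence `P_{T_S(x)}(-u) = 0`. It is obtained by the quadratic penalty method
(`exists_penalized_minimizer`): minimizers `y` of `f + m dist(·, S)² + ‖· - x‖²` on a small ball
carry regular subgradients close to `-2m (y - w)`, where `w` is the projection of `y` on `S`. These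
are bounded by twice the Lipschitz constant, and any cluster point as `m → ∞` is such a `u`. For the
iterates before termination it suffices that the projected subdifferential is nonempty, which is the
same condition with `{x}` in place of `S`. -/

namespace EquilibriumProblem

variable {E : Type*} [NormedAddCommGroup E] [InnerProductSpace ℝ E]

/-! ### Tangent cones and projections on them -/

/-- A sequence-free description of the tangent cone. -/
lemma mem_tangentCone_iff {C : Set E} {x d : E} :
    d ∈ tangentCone C x ↔
      ∀ ε > 0, ∃ y ∈ C, ∃ τ : ℝ, 0 < τ ∧ τ < ε ∧ ‖y - x‖ < ε ∧ ‖τ⁻¹ • (y - x) - d‖ < ε := by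
  constructor
  · rintro ⟨y, τ, hy, hyx, hτ, hτ0, hd⟩ ε hε
    have h1 := hτ0.eventually (gt_mem_nhds hε)
    have h2 := (tendsto_iff_norm_sub_tendsto_zero.1 hyx).eventually (gt_mem_nhds hε)
    have h3 := (tendsto_iff_norm_sub_tendsto_zero.1 hd).eventually (gt_mem_nhds hε)
    obtain ⟨k, h1, h2, h3⟩ := (h1.and (h2.and h3)).exists
    exact ⟨y k, hy k, τ k, hτ k, h1, h2, h3⟩
  · intro h
    choose y hy τ hτ hτε hyε hdε using fun k : ℕ => h (1 / ((k : ℝ) + 1)) (by positivity)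
    have h0 := tendsto_one_div_add_atTop_nhds_zero_nat (𝕜 := ℝ)
    refine ⟨y, τ, hy, ?_, hτ, ?_, ?_⟩
    · exact tendsto_iff_norm_sub_tendsto_zero.2
        (squeeze_zero (fun _ => norm_nonneg _) (fun k => (hyε k).le) h0)
    · exact squeeze_zero (fun k => (hτ k).le) (fun k => (hτε k).le) h0
    · exact tendsto_iff_norm_sub_tendsto_zero.2
        (squeeze_zero (fun _ => norm_nonneg _) (fun k => (hdε k).le) h0)

lemma zero_mem_tangentCone {C : Set E} {x : E} (hx : x ∈ C) : (0 : E) ∈ tangentCone C x :=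
  mem_tangentCone_iff.2 fun ε hε =>
    ⟨x, hx, ε / 2, by positivity, by linarith, by simpa, by simpa⟩

lemma isClosed_tangentCone (C : Set E) (x : E) : IsClosed (tangentCone C x) := by
  refine isClosed_of_closure_subset fun d hd => mem_tangentCone_iff.2 fun ε hε => ?_
  obtain ⟨e, he, hde⟩ := Metric.mem_closure_iff.1 hd (ε / 2) (half_pos hε)
  obtain ⟨y, hy, τ, hτ, h1, h2, h3⟩ := mem_tangentCone_iff.1 he (ε / 2) (half_pos hε)
  refine ⟨y, hy, τ, hτ, by linarith, by linarith, ?_⟩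
  rw [dist_comm, dist_eq_norm] at hde
  have := norm_sub_le_norm_sub_add_norm_sub (τ⁻¹ • (y - x)) e d
  linarith

lemma add_smul_mem_tangentCone {S : Set E} (hS : Convex ℝ S) {x z p : E}
    (hp : p ∈ tangentCone S x) (hz : z ∈ S) {t : ℝ} (ht : 0 < t) :
    p + t • (z - x) ∈ tangentCone S x := by
  obtain ⟨y, τ, hy, hyx, hτ, hτ0, hd⟩ := hp
  have h1 : Tendsto (fun k => t * τ k) atTop (𝓝 0) := by simpa using hτ0.const_mul t
  -- The tail of the sequence on which `t * τ k ≤ 1`, so that convexity of `S` applies.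
  obtain ⟨N, hN⟩ := eventually_atTop.1 (h1.eventually (gt_mem_nhds one_pos))
  have hshift := tendsto_add_atTop_nat N
  refine ⟨fun k => y (k + N) + (t * τ (k + N)) • (z - y (k + N)), fun k => τ (k + N), ?_, ?_,
    fun k => hτ _, hτ0.comp hshift, ?_⟩
  · intro k
    exact hS.add_smul_sub_mem (hy _) hz
      ⟨(mul_pos ht (hτ _)).le, (hN (k + N) (by omega)).le⟩
  · have : Tendsto (fun k => y k + (t * τ k) • (z - y k)) atTop (𝓝 (x + (0 : ℝ) • (z - x))) :=
      hyx.add (h1.smul (tendsto_const_nhds.sub hyx))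
    rw [zero_smul, add_zero] at this
    exact this.comp hshift
  · have : Tendsto (fun k => (τ k)⁻¹ • (y k - x) + t • (z - y k)) atTop
        (𝓝 (p + t • (z - x))) := hd.add ((tendsto_const_nhds.sub hyx).const_smul t)
    refine (this.comp hshift).congr fun k => ?_
    have hne := (hτ (k + N)).ne'
    simp only [Function.comp_apply]
    rw [add_sub_right_comm, smul_add, smul_smul]
    congr 2
    field_simp

lemma smul_sub_mem_tangentCone {S : Set E} (hS : Convex ℝ S) {x z : E} (hx : x ∈ S) (hz : z ∈ S)
    {t : ℝ} (ht : 0 < t) : t • (z - x) ∈ tangentCone S x := by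
  simpa using add_smul_mem_tangentCone hS (zero_mem_tangentCone hx) hz ht

lemma proj_nonempty {F : Type*} [NormedAddCommGroup F] [ProperSpace F] {C : Set F}
    (hC : IsClosed C) (hne : C.Nonempty) (x : F) :
    (proj C x).Nonempty := by
  obtain ⟨p, hp, h⟩ := hC.exists_infDist_eq_dist hne x
  refine ⟨p, hp, fun y hy => ?_⟩
  rw [← dist_eq_norm, ← dist_eq_norm, dist_comm p, dist_comm y, ← h]
  exact Metric.infDist_le_dist_of_mem hy

/-- If a vector `-u` makes no acute angle with the directions from `x` into `S`, then its
projection on the tangent cone is zero. -/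
lemma zero_mem_proj_tangentCone {S : Set E} {x u : E} (hx : x ∈ S)
    (hu : ∀ s ∈ S, 0 ≤ inner ℝ u (s - x)) : (0 : E) ∈ proj (tangentCone S x) (-u) := by
  refine ⟨zero_mem_tangentCone hx, ?_⟩
  rintro d ⟨y, τ, hy, -, hτ, -, hd⟩
  have hd0 : 0 ≤ inner ℝ u d := by
    refine ge_of_tendsto' (tendsto_const_nhds.inner hd) fun k => ?_
    rw [inner_smul_right]
    exact mul_nonneg (inv_pos.2 (hτ k)).le (hu _ (hy k))
  rw [zero_sub, neg_neg, sub_neg_eq_add]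
  refine le_of_sq_le_sq ?_ (norm_nonneg _)
  rw [norm_add_sq_real, real_inner_comm]
  nlinarith [sq_nonneg ‖d‖]

lemma nonneg_of_forall_pos_mul_add_sq {a b : ℝ} (h : ∀ t > 0, 0 ≤ t * a + t ^ 2 * b) :
    0 ≤ a := by
  have h0 : Tendsto (fun t : ℝ => a + t * b) (𝓝[>] 0) (𝓝 (a + 0 * b)) :=
    (Continuous.tendsto (by fun_prop) 0).mono_left nhdsWithin_le_nhds
  rw [zero_mul, add_zero] at h0
  refine ge_of_tendsto h0 (eventually_nhdsWithin_of_forall fun t ht => ?_)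
  have ht : 0 < t := ht
  have := h t ht
  exact nonneg_of_mul_nonneg_right (by linarith [sq t, mul_add t a (t * b), mul_assoc t t b] :
    0 ≤ t * (a + t * b)) ht

lemma inner_le_of_mem_proj_tangentCone {S : Set E} (hS : Convex ℝ S) {x z u p : E}
    (hz : z ∈ S) (hp : p ∈ proj (tangentCone S x) (-u)) :
    inner ℝ u (x - z) ≤ ‖p‖ * ‖x - z‖ := by
  have key : 0 ≤ 2 * inner ℝ (p + u) (z - x) := by
    refine nonneg_of_forall_pos_mul_add_sq (b := ‖z - x‖ ^ 2) fun t ht => ?_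
    have h := hp.2 _ (add_smul_mem_tangentCone hS hp.1 hz ht)
    rw [sub_neg_eq_add, sub_neg_eq_add, add_right_comm] at h
    have h2 := pow_le_pow_left₀ (norm_nonneg _) h 2
    rw [norm_add_sq_real (p + u), inner_smul_right, norm_smul, mul_pow, Real.norm_eq_abs, sq_abs] at h2
    linarith
  have h1 := real_inner_le_norm p (z - x)
  rw [inner_add_left] at key
  rw [← neg_sub z x, inner_neg_right, norm_neg]
  linarith

/-! ### Optimality condition for a locally Lipschitz function on a convex set -/

/-- Quadratic penalization of the constraint `S`: `y` is a minimizer of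
`f + m dist(·, S)² + ‖· - x‖²` on a ball around `x`, and `w` is its projection on `S`. The minimality
of `x` on `S` and the Lipschitz bound give the estimates, the second of which keeps `y` in the
interior of the ball, so that `y` is a local minimizer. -/
lemma exists_penalized_minimizer [ProperSpace E] {f : E → ℝ} {S : Set E} {x : E}
    (hS : IsClosed S) (hconv : Convex ℝ S) (hx : x ∈ S) (hmin : ∀ y ∈ S, f x ≤ f y)
    {L : NNReal} {r m : ℝ} (hr : 0 < r) (hL : LipschitzOnWith L f (Metric.closedBall x (2 * r)))
    (hm : 0 < m) (hmr : (L : ℝ) ^ 2 < m * r ^ 2) :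
    ∃ y w : E, (∀ s ∈ S, inner ℝ (y - w) (s - w) ≤ 0) ∧ m * ‖y - w‖ ≤ L ∧
      m * ‖y - x‖ ^ 2 ≤ (L : ℝ) ^ 2 ∧
      -((2 * m) • (y - w) + (2 : ℝ) • (y - x)) ∈ regularSubdifferential f y := by
  have hsub : Metric.closedBall x r ⊆ Metric.closedBall x (2 * r) :=
    Metric.closedBall_subset_closedBall (by linarith)
  obtain ⟨y, hy, hymin⟩ := (isCompact_closedBall x r).exists_isMinOn
    (f := fun y => f y + m * Metric.infDist y S ^ 2 + ‖y - x‖ ^ 2)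
    ⟨x, Metric.mem_closedBall_self hr.le⟩
    (((hL.continuousOn.mono hsub).add
      (((Metric.continuous_infDist_pt S).pow 2).const_mul m).continuousOn).add
      (by fun_prop))
  obtain ⟨w, hw, hyw⟩ := hS.exists_infDist_eq_dist ⟨x, hx⟩ y
  have hpen : ∀ z ∈ Metric.closedBall x r, ∀ s ∈ S,
      f y + m * ‖y - w‖ ^ 2 + ‖y - x‖ ^ 2 ≤ f z + m * ‖z - s‖ ^ 2 + ‖z - x‖ ^ 2 := by
    intro z hz s hs
    have h1 := isMinOn_iff.1 hymin z hz
    simp only [hyw, dist_eq_norm] at h1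
    have h2 : Metric.infDist z S ≤ ‖z - s‖ := by
      rw [← dist_eq_norm]; exact Metric.infDist_le_dist_of_mem hs
    have h3 := mul_le_mul_of_nonneg_left
      (pow_le_pow_left₀ Metric.infDist_nonneg h2 2) hm.le
    linarith
  have hyx : ‖y - x‖ ≤ r := by simpa [dist_eq_norm] using hy
  have hywx : ‖y - w‖ ≤ ‖y - x‖ := by
    rw [← dist_eq_norm, ← dist_eq_norm, ← hyw]; exact Metric.infDist_le_dist_of_mem hx
  have hwball : w ∈ Metric.closedBall x (2 * r) := by
    rw [mem_closedBall_iff_norm]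
    have := norm_sub_le_norm_sub_add_norm_sub w y x
    rw [norm_sub_rev w y] at this
    linarith
  have hlip : f w - f y ≤ L * ‖y - w‖ := by
    have := hL.dist_le_mul w hwball y (hsub hy)
    rw [Real.dist_eq, dist_comm w, dist_eq_norm] at this
    exact (le_abs_self _).trans this
  have hest : m * ‖y - w‖ ^ 2 + ‖y - x‖ ^ 2 ≤ L * ‖y - w‖ := by
    have := hpen x (Metric.mem_closedBall_self hr.le) x hx
    simp only [sub_self, norm_zero] at this
    linarith [hmin w hw]
  have hmw : m * ‖y - w‖ ≤ L := by
    rcases (norm_nonneg (y - w)).eq_or_lt with h | h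
    · rw [← h, mul_zero]; exact L.2
    · refine le_of_mul_le_mul_right ?_ h
      nlinarith [sq_nonneg ‖y - x‖]
  have hmx : m * ‖y - x‖ ^ 2 ≤ (L : ℝ) ^ 2 := by
    have h1 : ‖y - x‖ ^ 2 ≤ L * ‖y - w‖ := by nlinarith [mul_nonneg hm.le (sq_nonneg ‖y - w‖)]
    calc m * ‖y - x‖ ^ 2 ≤ m * (L * ‖y - w‖) := mul_le_mul_of_nonneg_left h1 hm.le
      _ = L * (m * ‖y - w‖) := by ring
      _ ≤ L * L := mul_le_mul_of_nonneg_left hmw L.2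
      _ = (L : ℝ) ^ 2 := by ring
  have hint : ‖y - x‖ < r := by
    refine lt_of_pow_lt_pow_left₀ 2 hr.le (lt_of_mul_lt_mul_left (hmx.trans_lt hmr) hm.le)
  refine ⟨y, w, ?_, hmw, hmx, ?_⟩
  · refine fun s hs => (norm_eq_iInf_iff_real_inner_le_zero hconv hw).1 ?_ s hs
    rw [← dist_eq_norm, ← hyw, Metric.infDist_eq_iInf]
    simp only [dist_eq_norm]
  · intro ε hε
    have hball : ∀ᶠ z in 𝓝 y, z ∈ Metric.closedBall x r :=
      Metric.closedBall_mem_nhds_of_mem (mem_ball_iff_norm.2 hint)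
    have hsmall : ∀ᶠ z in 𝓝 y, (m + 1) * ‖z - y‖ < ε := by
      have : Tendsto (fun z => (m + 1) * ‖z - y‖) (𝓝 y) (𝓝 ((m + 1) * ‖y - y‖)) :=
        Continuous.tendsto (by fun_prop) y
      rw [sub_self, norm_zero, mul_zero] at this
      exact this.eventually (gt_mem_nhds hε)
    filter_upwards [hball, hsmall] with z hz hzε
    have h1 := hpen z hz w hw
    have hexp : ∀ a : E, ‖z - a‖ ^ 2
        = ‖y - a‖ ^ 2 + 2 * inner ℝ (y - a) (z - y) + ‖z - y‖ ^ 2 := by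
      intro a
      rw [← norm_add_sq_real, sub_add_sub_cancel']
    rw [hexp w, hexp x] at h1
    rw [inner_neg_left, inner_add_left, real_inner_smul_left, real_inner_smul_left]
    have h2 := mul_le_mul_of_nonneg_right hzε.le (norm_nonneg (z - y))
    nlinarith

/-- The optimality condition `0 ∈ ∂f(x) + N_S(x)` for a minimizer `x` of `f` on `S`. -/
lemma exists_mem_subdifferential_inner_nonneg [ProperSpace E] {f : E → ℝ} {S : Set E} {x : E}
    (hf : LocallyLipschitz f) (hS : IsClosed S) (hconv : Convex ℝ S) (hx : x ∈ S)
    (hmin : ∀ y ∈ S, f x ≤ f y) :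
    ∃ u ∈ subdifferential f x, ∀ s ∈ S, 0 ≤ inner ℝ u (s - x) := by
  obtain ⟨L, t, ht, hLt⟩ := hf x
  obtain ⟨ρ, hρ, hρt⟩ := Metric.nhds_basis_closedBall.mem_iff.1 ht
  have hL : LipschitzOnWith L f (Metric.closedBall x (2 * (ρ / 2))) :=
    hLt.mono (by rwa [mul_div_cancel₀ ρ two_ne_zero])
  have hr : 0 < ρ / 2 := half_pos hρ
  obtain ⟨N, hN⟩ := exists_nat_gt ((L : ℝ) ^ 2 / (ρ / 2) ^ 2)
  rw [div_lt_iff₀ (by positivity)] at hN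
  have hmpos : ∀ k : ℕ, (0 : ℝ) < N + k + 1 := fun k => by positivity
  choose y w hw hyw hyx hsub using fun k : ℕ =>
    exists_penalized_minimizer hS hconv hx hmin hr hL (hmpos k)
      (hN.trans_le (mul_le_mul_of_nonneg_right (by linarith [k.cast_nonneg (α := ℝ)])
        (by positivity)))
  have hinv : ∀ c : ℝ, Tendsto (fun k : ℕ => c / ((N : ℝ) + k + 1)) atTop (𝓝 0) := fun c =>
    tendsto_const_nhds.div_atTop
      (tendsto_atTop_add_const_right _ _
        (tendsto_atTop_add_const_left _ _ tendsto_natCast_atTop_atTop))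
  have hy0 : Tendsto (fun k => y k - x) atTop (𝓝 0) := by
    refine tendsto_zero_iff_norm_tendsto_zero.2 ?_
    have h := squeeze_zero (fun k => sq_nonneg ‖y k - x‖)
      (fun k => (le_div_iff₀' (hmpos k)).2 (hyx k)) (hinv _)
    simpa [Real.sqrt_sq] using h.sqrt
  have hw0 : Tendsto (fun k => y k - w k) atTop (𝓝 0) :=
    tendsto_zero_iff_norm_tendsto_zero.2 (squeeze_zero (fun k => norm_nonneg _)
      (fun k => (le_div_iff₀' (hmpos k)).2 (hyw k)) (hinv _))
  have hy : Tendsto y atTop (𝓝 x) := by simpa using hy0.add_const x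
  have hwx : Tendsto w atTop (𝓝 x) := by simpa using hy.sub hw0
  obtain ⟨g, -, θ, hθ, hg⟩ := tendsto_subseq_of_bounded
    (x := fun k => (2 * ((N : ℝ) + k + 1)) • (y k - w k))
    (Metric.isBounded_closedBall (x := (0 : E)) (r := 2 * L)) (fun k => by
      have := hmpos k
      rw [mem_closedBall_zero_iff, norm_smul, Real.norm_of_nonneg (by positivity), mul_assoc]
      exact mul_le_mul_of_nonneg_left (hyw k) two_pos.le)
  have hθ' := hθ.tendsto_atTop
  refine ⟨-g, ⟨fun k => y (θ k), _, hy.comp hθ', (hf.continuous.tendsto x).comp (hy.comp hθ'),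
    fun k => hsub (θ k), ?_⟩, fun s hs => ?_⟩
  · simpa using (hg.add ((hy0.comp hθ').const_smul (2 : ℝ))).neg
  · rw [inner_neg_left, neg_nonneg]
    refine le_of_tendsto' (hg.inner (tendsto_const_nhds.sub (hwx.comp hθ'))) fun k => ?_
    have := hmpos (θ k)
    simp only [Function.comp_apply]
    rw [real_inner_smul_left]
    exact mul_nonpos_of_nonneg_of_nonpos (by positivity) (hw _ s hs)

lemma projectedSubdifferential_nonempty [ProperSpace E] {f : E → ℝ} (hf : LocallyLipschitz f)
    {S : Set E} {x : E} (hx : x ∈ S) : (projectedSubdifferential S f x).Nonempty := by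
  obtain ⟨u, hu, -⟩ := exists_mem_subdifferential_inner_nonneg hf isClosed_singleton
    (convex_singleton x) rfl (fun y hy => by rw [Set.mem_singleton_iff.1 hy])
  obtain ⟨p, hp⟩ := proj_nonempty (isClosed_tangentCone S x) ⟨0, zero_mem_tangentCone hx⟩ (-u)
  exact ⟨p, u, hu, hp⟩

lemma zero_mem_projectedSubdifferential [ProperSpace E] {f : E → ℝ} (hf : LocallyLipschitz f)
    {S : Set E} (hS : IsClosed S) (hconv : Convex ℝ S) {x : E} (hx : x ∈ S)
    (hmin : ∀ y ∈ S, f x ≤ f y) : (0 : E) ∈ projectedSubdifferential S f x := by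
  obtain ⟨u, hu, hus⟩ := exists_mem_subdifferential_inner_nonneg hf hS hconv hx hmin
  exact ⟨u, hu, zero_mem_proj_tangentCone hx hus⟩

/-! ### Directions from nearest points -/

lemma smul_sub_mem_regularNormalCone {T : Set E} {x z : E} (hz : z ∈ proj T x) {t : ℝ}
    (ht : 0 < t) : t • (x - z) ∈ regularNormalCone T z := by
  intro ε hε
  have hsmall : ∀ᶠ y in 𝓝[T] z, t * ‖y - z‖ < ε := by
    have : Tendsto (fun y => t * ‖y - z‖) (𝓝 z) (𝓝 (t * ‖z - z‖)) :=
      Continuous.tendsto (by fun_prop) z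
    rw [sub_self, norm_zero, mul_zero] at this
    exact (this.mono_left nhdsWithin_le_nhds).eventually (gt_mem_nhds hε)
  filter_upwards [hsmall, self_mem_nhdsWithin] with y hy hyT
  -- Since `z` is nearest to `x`, `2 ⟪x - z, y - z⟫ ≤ ‖y - z‖ ^ 2`.
  have h1 := pow_le_pow_left₀ (norm_nonneg _) (hz.2 y hyT) 2
  rw [norm_sub_rev z, norm_sub_rev y, ← sub_sub_sub_cancel_right x y z,
    norm_sub_sq_real (x - z)] at h1
  rw [real_inner_smul_left]
  have h2 := mul_le_mul_of_nonneg_right hy.le (norm_nonneg (y - z))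
  have h3 : inner ℝ (x - z) (y - z) ≤ ‖y - z‖ ^ 2 := by linarith [sq_nonneg ‖y - z‖]
  have h4 := mul_le_mul_of_nonneg_left h3 ht.le
  linarith [sq ‖y - z‖, mul_assoc t ‖y - z‖ ‖y - z‖, congrArg (t * ·) (sq ‖y - z‖)]

lemma exists_le_inner_of_smul_closedBall_subset {A D : Set E} {α : ℝ}
    (hA : α • Metric.closedBall (0 : E) 1 ⊆ A + polarCone D) {d : E} (hd : d ∈ D)
    (hnorm : ‖d‖ = 1) : ∃ v ∈ A, α ≤ inner ℝ v d := by
  obtain ⟨v, hv, w, hw, hvw⟩ := Set.mem_add.1 <|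
    hA (Set.smul_mem_smul_set (mem_closedBall_zero_iff.2 hnorm.le))
  refine ⟨v, hv, ?_⟩
  have h1 : inner ℝ (v + w) d = α := by
    rw [hvw, real_inner_smul_left, real_inner_self_eq_norm_sq, hnorm]; ring
  rw [inner_add_left] at h1
  linarith [hw d hd]

/-! ### Finite termination -/

/-- If the projected subgradients tend to zero, then weak sharpness forces all but finitely many
iterates into the solution set. -/
lemma finite_notMem_solutionSet {φ : E → E → ℝ} {S : Set E} (hconv : Convex ℝ S) {x : ℕ → E}
    (hx : ∀ k, x k ∈ S) (hsharp : AugmentedWeaklySharp φ S x)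
    (h0 : (0 : E) ∈ setLiminf fun k => projectedSubdifferential S (φ (x k)) (x k)) :
    {k | x k ∉ solutionSet φ S}.Finite := by
  by_contra hinf
  obtain ⟨H, z, hz, ⟨α, hα, hH⟩, hlim⟩ := hsharp hinf
  obtain ⟨p, hp, hp0⟩ := h0
  choose u hu hpu using hp
  have hpos : ∀ k ∈ {k | x k ∉ solutionSet φ S}, 0 < ‖x k - z k‖ := by
    intro k hk
    refine norm_pos_iff.2 (sub_ne_zero.2 fun h => hk ?_)
    rw [h]
    exact (hz k hk).1
  have hv : ∀ k, ∃ v, k ∈ {k | x k ∉ solutionSet φ S} →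
      v ∈ H (z k) ∧ α ≤ inner ℝ v (‖x k - z k‖⁻¹ • (x k - z k)) := by
    intro k
    by_cases hk : k ∈ {k | x k ∉ solutionSet φ S}
    · have ht := inv_pos.2 (hpos k hk)
      obtain ⟨v, hv, hαv⟩ := exists_le_inner_of_smul_closedBall_subset (hH _ (hz k hk).1)
        ⟨smul_sub_mem_tangentCone hconv (hz k hk).1.1 (hx k) ht,
          smul_sub_mem_regularNormalCone (hz k hk) ht⟩
        (by rw [norm_smul, norm_inv, norm_norm, inv_mul_cancel₀ (hpos k hk).ne'])
      exact ⟨v, fun _ => ⟨hv, hαv⟩⟩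
    · exact ⟨0, fun h => absurd h hk⟩
  choose v hv using hv
  have hle := hlim u v (fun k _ => hu k) (fun k hk => (hv k hk).1)
  have hsmall : ∀ᶠ k in atTop, ‖p k‖ < α / 2 :=
    (tendsto_zero_iff_norm_tendsto_zero.1 hp0).eventually (gt_mem_nhds (half_pos hα))
  have hev : ∀ᶠ k in atTop ⊓ 𝓟 {k | x k ∉ solutionSet φ S},
      ((1 / ‖x k - z k‖ * inner ℝ (u k - v k) (x k - z k) : ℝ) : EReal)
        ≤ ((-(α / 2) : ℝ) : EReal) := by
    rw [eventually_inf_principal]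
    filter_upwards [hsmall] with k hpk hk
    rw [EReal.coe_le_coe_iff, one_div, inner_sub_left, mul_sub]
    have h1 := (hv k hk).2
    rw [inner_smul_right] at h1
    have h2 := inner_le_of_mem_proj_tangentCone hconv (hz k hk).1.1 (hpu k)
    have h3 : ‖x k - z k‖⁻¹ * inner ℝ (u k) (x k - z k) ≤ ‖p k‖ := by
      rw [inv_mul_le_iff₀ (hpos k hk)]
      linarith
    linarith
  -- The filter need not be known to be nontrivial: `limsup ≤` holds in `EReal` regardless.
  have hcontra := hle.trans (limsup_le_of_le (h := hev))
  rw [← EReal.coe_zero, EReal.coe_le_coe_iff] at hcontra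
  linarith

end EquilibriumProblem

theorem corollary5p2 {n : ℕ} (S : Set (EuclideanSpace ℝ (Fin n)))
    (hS_closed : IsClosed S) (hS_convex : Convex ℝ S)
    (φ : EuclideanSpace ℝ (Fin n) → EuclideanSpace ℝ (Fin n) → ℝ)
    (hφ : ∀ x ∈ S, φ x x = 0)
    (hsol_nonempty : (EquilibriumProblem.solutionSet φ S).Nonempty)
    (hsol_closed : IsClosed (EquilibriumProblem.solutionSet φ S))
    (hlip : ∀ x ∈ S, LocallyLipschitz (φ x))
    (x : ℕ → EuclideanSpace ℝ (Fin n)) (hx : ∀ k, x k ∈ S)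
    (hsharp : EquilibriumProblem.AugmentedWeaklySharp φ S x) :
    EquilibriumProblem.TerminatesFinitely x (EquilibriumProblem.solutionSet φ S) ↔
      (0 : EuclideanSpace ℝ (Fin n)) ∈ EquilibriumProblem.setLiminf
        (fun k => EquilibriumProblem.projectedSubdifferential S (φ (x k)) (x k)) := by
  open EquilibriumProblem in
  constructor
  · rintro ⟨k₀, hk₀⟩
    choose p hp using fun k => projectedSubdifferential_nonempty (hlip _ (hx k)) (hx k)
    refine ⟨fun k => if k < k₀ then p k else 0, fun k => ?_, ?_⟩
    · dsimp only
      split_ifs with hk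
      · exact hp k
      · refine zero_mem_projectedSubdifferential (hlip _ (hx k)) hS_closed hS_convex (hx k) ?_
        rw [hφ _ (hx k)]
        exact (hk₀ k (not_lt.1 hk)).2
    · refine tendsto_const_nhds.congr' ?_
      filter_upwards [eventually_ge_atTop k₀] with k hk
      rw [if_neg (not_lt.2 hk)]
  · intro h0
    have hfin := finite_notMem_solutionSet hS_convex hx hsharp h0
    obtain ⟨M, hM⟩ := hfin.bddAbove
    refine ⟨M + 1, fun k hk => ?_⟩
    by_contra hkT
    exact absurd (hM hkT) (by omega)
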